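/- Let $x=(x_1,\dots,x_n)$ and let $H=(H_1,\dots,H_n)$ with $H_i\in\mathbb{C}[x]=\mathbb{C}[x_1,\dots,x_n]$. The polynomial map $x+H$ is called a quasi-translation if $(x-H)\circ(x+H)=x$, that is, if $x-H$ is the inverse polynomial map of $x+H$. It is called homogeneous if there is a $d\in\mathbb{N}=\{0,1,2,\dots\}$ such that each $H_i$ is either zero or homogeneous of degree $d$. Assume that $x+H$ is a homogeneous quasi-translation in dimension $n$ over $\mathbb{C}$, where $n = 3$ or $n = 4$. Then there exists an invertible $n\times n$ matrix $T$ over $\mathbb{C}$ such that $T^{-1}H(Tx)$ is of the form (1) $(0,0,g)$, where $g\in\mathbb{C}[x_1,x_2]$, if $n=3$; (2) $(0,0,b\,g,a\,g)$, where $a,b\in\mathbb{C}[x_1,x_2]$ and $g\in\mathbb{C}[x_1,x_2,\,a x_3-b x_4]$, if $n=4$. -/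

import Mathlib

namespace QuasiTrans

/-- A polynomial map from affine `n`-space over `R` to itself, given by its `n` components
in `R[x_0, …, x_{n-1}]`. -/
abbrev PolyMap (n : ℕ) (R : Type*) [CommRing R] : Type _ :=
  Fin n → MvPolynomial (Fin n) R

variable {n : ℕ} {R : Type*} [CommRing R]

/-- The identity polynomial map `x = (x_0, …, x_{n-1})`. -/
noncomputable def idMap (n : ℕ) (R : Type*) [CommRing R] : PolyMap n R :=
  fun i => MvPolynomial.X i

/-- The composition `F ∘ G` of polynomial maps: the components of `G` are substituted for the
variables in each component of `F`. -/
noncomputable def comp (F G : PolyMap n R) : PolyMap n R :=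
  fun i => MvPolynomial.bind₁ G (F i)

/-- The linear polynomial map `x ↦ M x` of a square matrix `M`. -/
noncomputable def linMap (M : Matrix (Fin n) (Fin n) R) : PolyMap n R :=
  fun i => ∑ j, MvPolynomial.C (M i j) * MvPolynomial.X j

/-- `x + H` is a quasi-translation: `(x - H) ∘ (x + H) = x`. -/
def IsQuasiTranslation (H : PolyMap n R) : Prop :=
  comp (idMap n R - H) (idMap n R + H) = idMap n R

/-- There is a `d` such that every component of `H` is zero or homogeneous of degree `d`
(in Mathlib the zero polynomial is homogeneous of every degree). -/
def IsHomogeneousMap (H : PolyMap n R) : Prop :=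
  ∃ d : ℕ, ∀ i, (H i).IsHomogeneous d

/-- The linear conjugate `T⁻¹ H(T x)` of `H` by an invertible matrix `T`. -/
noncomputable def linConj (T : Matrix.GeneralLinearGroup (Fin n) R) (H : PolyMap n R) :
    PolyMap n R :=
  comp (linMap (T⁻¹ : Matrix.GeneralLinearGroup (Fin n) R).val) (comp H (linMap T.val))

end QuasiTrans

/-! Iterating the quasi-translation shows that every component of H is constant along each line x +
tH(x). Write H = g h, where the components of h have no common factor. Factors of invariants are
invariant and factors of homogeneous polynomials are homogeneous, so the h_i have one degree d and
are constant along x + t h(x). For d > 0, letting t grow gives h(h(x)) = 0. Having no common factor,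
the h_i cut out a set of codimension at least 2, so the image of h has dimension at most n - 2
(`not_algebraicIndependent_linearCombination`).

This yields two independent linear relations between the h_i. For n = 3 any two linear combinations
of the h_i satisfy a binary form, so they are proportional over ℂ. For n = 4, assume that h is not
everywhere parallel to one fixed vector, and let v = h(z) ≠ 0. There is a hypersurface on which h is
parallel to v and which contains the cone of all s h(y) + t v. Exchanging v and h(y), one sees that
h is parallel to both at h(y) + t v, hence vanishes there. So the cone has dimension at most 2, its
projection from v has dimension at most 1, and the combinations l · h with l ⊥ v are pairwise
proportional.

In coordinates adapted to the relations, H has two zero components. What remains is to find the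
invariants of a derivation b ∂₂ + a ∂₃ with a, b coprime: a, b themselves involve only x₀, x₁, and
repeated division by a x₂ - b x₃ puts g into the required algebra. -/

section

open MvPolynomial

/-! ### Homogeneous factors and content -/

/-- A factor of a nonzero homogeneous polynomial is homogeneous. -/
theorem MvPolynomial.IsHomogeneous.of_mul_left {σ K : Type*} [CommRing K] [IsDomain K]
    {f g : MvPolynomial σ K} {n : ℕ} (h : (f * g).IsHomogeneous n) (hne : f * g ≠ 0) :
    ∃ m, f.IsHomogeneous m := by
  -- Substituting x_i T for x_i turns the degree k component into the coefficient of T^k. Degree and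
  -- trailing degree in T are both additive, so factors of a single term in T are single terms.
  let Φ : MvPolynomial σ K →ₐ[K] Polynomial (MvPolynomial σ K) :=
    MvPolynomial.aeval fun i => Polynomial.C (X i) * Polynomial.X
  have key : ∀ (p : MvPolynomial σ K) (k : ℕ), p.IsHomogeneous k →
      Φ p = Polynomial.C p * Polynomial.X ^ k := by
    intro p k hp
    rw [p.as_sum, map_sum, map_sum, Finset.sum_mul]
    refine Finset.sum_congr rfl fun m hm => ?_
    have hk : m.degree = k := by
      by_contra hne
      exact (mem_support_iff.1 hm) (hp.coeff_eq_zero hne)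
    rw [aeval_monomial, ← hk, monomial_eq, map_mul]
    simp only [mul_pow, Finsupp.prod, Finset.prod_mul_distrib, map_prod, map_pow,
      Finset.prod_pow_eq_pow_sum, Finsupp.degree]
    rw [← mul_assoc]
    rfl
  have hinj : ∀ p, Φ p = 0 → p = 0 := by
    intro p hp
    have := congrArg (Polynomial.eval (1 : MvPolynomial σ K)) hp
    have h2 : (Polynomial.evalRingHom (1 : MvPolynomial σ K)).comp Φ.toRingHom = RingHom.id _ := by
      apply MvPolynomial.ringHom_ext
      · intro r; simp [Φ, Polynomial.algebraMap_apply]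
      · intro i; simp [Φ]
    have h3 := congrArg (fun e => e p) h2
    simpa [hp] using h3.symm
  have hmul : Φ f * Φ g = Polynomial.C (f * g) * Polynomial.X ^ n := by
    rw [← map_mul, key _ _ h]
  have hf0 : Φ f ≠ 0 := fun h0 => hne (by rw [hinj f h0, zero_mul])
  have hg0 : Φ g ≠ 0 := fun h0 => hne (by rw [hinj g h0, mul_zero])
  have hd := Polynomial.natDegree_mul hf0 hg0
  have ht := Polynomial.natTrailingDegree_mul hf0 hg0
  rw [hmul, Polynomial.natDegree_C_mul_X_pow n _ hne] at hd
  rw [hmul, Polynomial.C_mul_X_pow_eq_monomial, Polynomial.natTrailingDegree_monomial hne] at ht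
  have h1 := Polynomial.natTrailingDegree_le_natDegree (Φ f)
  have h2 := Polynomial.natTrailingDegree_le_natDegree (Φ g)
  have hfd : (Φ f).natTrailingDegree = (Φ f).natDegree := by omega
  refine ⟨(Φ f).natDegree, ?_⟩
  have hcoef : ∀ k, (Φ f).coeff k = homogeneousComponent k f := by
    intro k
    conv_lhs => rw [← sum_homogeneousComponent f, map_sum, Polynomial.finsetSum_coeff]
    simp_rw [fun i => key _ i (homogeneousComponent_isHomogeneous i f), Polynomial.coeff_C_mul_X_pow]
    rw [Finset.sum_ite_eq]
    split_ifs with hk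
    · rfl
    · rw [homogeneousComponent_eq_zero]
      simpa using hk
  have hsum : (∑ i ∈ Finset.range (f.totalDegree + 1), homogeneousComponent i f).IsHomogeneous
      (Φ f).natDegree := ?_
  · rwa [sum_homogeneousComponent] at hsum
  refine MvPolynomial.IsHomogeneous.sum _ _ _ fun k _ => ?_
  by_cases hk : k = (Φ f).natDegree
  · rw [← hk]; exact homogeneousComponent_isHomogeneous k f
  · rw [← hcoef]
    have : (Φ f).coeff k = 0 := by
      rcases lt_or_gt_of_ne hk with hlt | hgt
      · exact Polynomial.coeff_eq_zero_of_lt_natTrailingDegree (by omega)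
      · exact Polynomial.coeff_eq_zero_of_natDegree_lt hgt
    rw [this]; exact isHomogeneous_zero _ _ _

/-- A nonzero family in a unique factorization domain is a multiple of a family without
common factors. -/
theorem exists_eq_mul_of_ne_zero {ι R : Type*} [Fintype ι] [CommRing R] [IsDomain R]
    [UniqueFactorizationMonoid R] (H : ι → R) (hH : H ≠ 0) :
    ∃ (g : R) (h : ι → R), g ≠ 0 ∧ (∀ i, H i = g * h i) ∧
      ∀ c, (∀ i, c ∣ h i) → IsUnit c := by
  classical
  let _ := Classical.choice (inferInstance : Nonempty (NormalizedGCDMonoid R))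
  obtain ⟨i, hi⟩ := Function.ne_iff.1 hH
  obtain ⟨h, he, hg⟩ := Finset.extract_gcd H (s := Finset.univ) ⟨i, Finset.mem_univ i⟩
  refine ⟨Finset.univ.gcd H, h, fun h0 => hi ?_, fun i => he i (Finset.mem_univ i), fun c hc => ?_⟩
  · exact Finset.gcd_eq_zero_iff.1 h0 i (Finset.mem_univ i)
  · exact isUnit_of_dvd_one (hg ▸ Finset.dvd_gcd fun i _ => hc i)

/-! ### Kernels of substitutions with large image -/

/-- The kernel of a homomorphism from `A[X]` to a domain which is injective on the
coefficients consists of multiples of a non-unit. -/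
theorem Polynomial.exists_dvd_of_injective_comp_C {A B : Type*} [CommRing A] [IsDomain A]
    [UniqueFactorizationMonoid A] [CommRing B] [IsDomain B] (φ : Polynomial A →+* B)
    (hφ : Function.Injective (φ.comp Polynomial.C)) :
    ∃ p : Polynomial A, ¬ IsUnit p ∧ ∀ f, φ f = 0 → p ∣ f := by
  by_cases hbot : RingHom.ker φ = ⊥
  · refine ⟨0, not_isUnit_zero, fun f hf => ?_⟩
    have : f ∈ RingHom.ker φ := hf
    rw [hbot, Ideal.mem_bot] at this
    rw [this]
  obtain ⟨p, hpk, hp⟩ := (RingHom.ker_isPrime φ).exists_mem_prime_of_ne_bot hbot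
  refine ⟨p, hp.not_isUnit, fun f hf => ?_⟩
  have hpk : φ p = 0 := hpk
  have hdeg : p.natDegree ≠ 0 := by
    intro h0
    rw [Polynomial.eq_C_of_natDegree_eq_zero h0] at hpk
    have h1 : p.coeff 0 = 0 := (injective_iff_map_eq_zero _).1 hφ _ hpk
    apply hp.ne_zero
    rw [Polynomial.eq_C_of_natDegree_eq_zero h0, h1, map_zero]
  have hprim : p.IsPrimitive := hp.irreducible.isPrimitive hdeg
  have hirr := (hprim.irreducible_iff_irreducible_map_fraction_map (K := FractionRing A)).1
    hp.irreducible
  -- By Gauss's lemma p and f are coprime over the fraction field of A. The Bézout identity maps to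
  -- 0 = 1 under the extension ψ of φ.
  by_contra hnd
  have hnd' : ¬ p.map (algebraMap A (FractionRing A)) ∣ f.map (algebraMap A (FractionRing A)) :=
    fun h => hnd ((hprim.dvd_iff_fraction_map_dvd_fraction_map (FractionRing A)).2 h)
  obtain ⟨u, v, huv⟩ := (hirr.coprime_iff_not_dvd).2 hnd'
  have hinj : Function.Injective ((algebraMap B (FractionRing B)).comp (φ.comp Polynomial.C)) :=
    (IsFractionRing.injective B (FractionRing B)).comp hφ
  let ψ : Polynomial (FractionRing A) →+* FractionRing B :=
    Polynomial.eval₂RingHom (IsFractionRing.lift hinj)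
      (algebraMap B (FractionRing B) (φ Polynomial.X))
  have hψ : ψ.comp (Polynomial.mapRingHom (algebraMap A (FractionRing A))) =
      (algebraMap B (FractionRing B)).comp φ := by
    apply Polynomial.ringHom_ext
    · intro a
      simp [ψ]
    · simp [ψ]
  have hψ' : ∀ q, φ q = 0 → ψ (q.map (algebraMap A (FractionRing A))) = 0 := by
    intro q hq
    have := congrArg (fun e => e q) hψ
    simpa [hq] using this
  have := congrArg ψ huv
  rw [map_add, map_mul, map_mul, hψ' p hpk, hψ' f hf] at this
  simp at this

theorem MvPolynomial.exists_dvd_of_algebraicIndependent_succ {K B : Type*} [Field K] [CommRing B]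
    [IsDomain B] [Algebra K B] {k : ℕ} (φ : MvPolynomial (Fin (k + 1)) K →ₐ[K] B)
    (hφ : AlgebraicIndependent K fun i : Fin k => φ (X i.succ)) :
    ∃ p : MvPolynomial (Fin (k + 1)) K, ¬ IsUnit p ∧ ∀ f, φ f = 0 → p ∣ f := by
  let e := finSuccEquiv K k
  have hC : (((φ.comp e.symm.toAlgHom).toRingHom).comp Polynomial.C : MvPolynomial (Fin k) K →+* B)
      = (aeval fun i : Fin k => φ (X i.succ)).toRingHom := by
    apply MvPolynomial.ringHom_ext
    · intro r
      have : e.symm (Polynomial.C (C r)) = C r := by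
        rw [AlgEquiv.symm_apply_eq]; simp [e, finSuccEquiv_apply]
      simp [this]
    · intro i
      have : e.symm (Polynomial.C (X i)) = X i.succ := by
        rw [AlgEquiv.symm_apply_eq]; simp [e, finSuccEquiv_X_succ]
      simp [this]
  obtain ⟨p, hp, hdvd⟩ := Polynomial.exists_dvd_of_injective_comp_C
    (φ.comp e.symm.toAlgHom).toRingHom (by rw [hC]; exact hφ)
  refine ⟨e.symm p, fun hu => hp ?_, fun f hf => ?_⟩
  · simpa using hu.map e
  · have := hdvd (e f) (by simpa using hf)
    simpa using map_dvd e.symm this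

/-- The linear change of variables attached to an invertible matrix. -/
noncomputable def MvPolynomial.linearAlgEquiv {K : Type*} [Field K] {n : ℕ}
    (M : Matrix.GeneralLinearGroup (Fin n) K) :
    MvPolynomial (Fin n) K ≃ₐ[K] MvPolynomial (Fin n) K :=
  have aux : ∀ M N : Matrix.GeneralLinearGroup (Fin n) K, N * M = 1 →
      (aeval fun i => ∑ j, M.val i j • X j : MvPolynomial (Fin n) K →ₐ[K] _).comp
        (aeval fun i => ∑ j, N.val i j • X j) = AlgHom.id K _ := by
    intro M N h
    apply MvPolynomial.algHom_ext
    intro i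
    have h' : N.val * M.val = 1 := by rw [← Units.val_mul, h, Units.val_one]
    simp only [AlgHom.comp_apply, aeval_X, map_sum, map_smul, Finset.smul_sum, AlgHom.id_apply]
    rw [Finset.sum_comm]
    simp_rw [smul_smul, ← Finset.sum_smul]
    have : ∀ j, ∑ x, N.val i x * M.val x j = (1 : Matrix (Fin n) (Fin n) K) i j := by
      intro j; rw [← h', Matrix.mul_apply]
    simp_rw [this]
    simp [Matrix.one_apply]
  AlgEquiv.ofAlgHom (aeval fun i => ∑ j, M.val i j • X j)
    (aeval fun i => ∑ j, M⁻¹.val i j • X j) (aux _ _ (by simp)) (aux _ _ (by simp))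

theorem MvPolynomial.linearAlgEquiv_X {K : Type*} [Field K] {n : ℕ}
    (M : Matrix.GeneralLinearGroup (Fin n) K) (i : Fin n) :
    linearAlgEquiv M (X i) = ∑ j, M.val i j • X j := by
  simp [linearAlgEquiv]

theorem exists_generalLinearGroup_of_linearIndependent {K : Type*} [Field K] {n : ℕ}
    {l : Fin n → Fin n → K} (hl : LinearIndependent K l) :
    ∃ M : Matrix.GeneralLinearGroup (Fin n) K, ∀ i j, M.val i j = l i j := by
  have hu : IsUnit (Matrix.of l) := Matrix.linearIndependent_rows_iff_isUnit.1 hl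
  exact ⟨hu.unit, fun i j => rfl⟩

/-- If `n` linear forms in `n + 1` variables have algebraically independent images under an
algebra homomorphism to a domain, then all members of the kernel have a common factor. -/
theorem MvPolynomial.exists_dvd_of_algebraicIndependent_linear {K B : Type*} [Field K]
    [CommRing B] [IsDomain B] [Algebra K B] {k : ℕ} (φ : MvPolynomial (Fin (k + 1)) K →ₐ[K] B)
    (l : Fin k → Fin (k + 1) → K)
    (hφ : AlgebraicIndependent K fun i => ∑ j, l i j • φ (X j)) :
    ∃ p : MvPolynomial (Fin (k + 1)) K, ¬ IsUnit p ∧ ∀ f, φ f = 0 → p ∣ f := by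
  have hl : LinearIndependent K l := by
    have h1 := hφ.linearIndependent
    refine LinearIndependent.of_comp (Fintype.linearCombination K fun j => φ (X j)) ?_
    exact h1
  -- One more form completes `l` to a coordinate system in which the given forms are the last k
  -- variables.
  obtain ⟨v, hv⟩ := exists_linearIndependent_cons_of_lt_finrank hl (by simp)
  obtain ⟨M, hM⟩ := exists_generalLinearGroup_of_linearIndependent hv
  obtain ⟨p, hp, hdvd⟩ := exists_dvd_of_algebraicIndependent_succ
    (φ.comp (linearAlgEquiv M).toAlgHom) (by
      convert hφ using 2 with i
      simp [linearAlgEquiv_X, hM])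
  refine ⟨linearAlgEquiv M p, fun hu => hp ?_, fun f hf => ?_⟩
  · simpa using hu.map (linearAlgEquiv M).symm
  · have := hdvd ((linearAlgEquiv M).symm f) (by simpa using hf)
    simpa using map_dvd (linearAlgEquiv M) this

/-! ### Homogeneous algebraic relations -/

/-- Algebraically dependent homogeneous polynomials of the same positive degree satisfy a
homogeneous relation. -/
theorem MvPolynomial.exists_isHomogeneous_aeval_eq_zero {σ τ K : Type*} [Field K]
    {A : τ → MvPolynomial σ K} {d : ℕ} (hd : d ≠ 0) (hA : ∀ i, (A i).IsHomogeneous d)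
    (h : ¬ AlgebraicIndependent K A) :
    ∃ (k : ℕ) (R : MvPolynomial τ K), R.IsHomogeneous k ∧ R ≠ 0 ∧ MvPolynomial.aeval A R = 0 := by
  rw [algebraicIndependent_iff] at h
  push Not at h
  obtain ⟨R, hR, hR0⟩ := h
  have hk : ∃ k, homogeneousComponent k R ≠ 0 := by
    by_contra! hc
    apply hR0
    rw [← sum_homogeneousComponent R]
    exact Finset.sum_eq_zero fun k _ => hc k
  obtain ⟨k, hk⟩ := hk
  refine ⟨k, homogeneousComponent k R, homogeneousComponent_isHomogeneous _ _, hk, ?_⟩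
  have hcomp := congrArg (homogeneousComponent (d * k)) hR
  rw [← sum_homogeneousComponent R, map_sum, map_sum, map_zero] at hcomp
  have hh : ∀ i, (MvPolynomial.aeval A (homogeneousComponent i R)).IsHomogeneous (d * i) :=
    fun i => (homogeneousComponent_isHomogeneous i R).aeval A hA
  rw [Finset.sum_eq_single k] at hcomp
  · rwa [homogeneousComponent_eq_self (hh k)] at hcomp
  · intro i _ hik
    rw [homogeneousComponent_of_mem (hh i), if_neg]
    intro h
    exact hik (Nat.eq_of_mul_eq_mul_left (Nat.pos_of_ne_zero hd) h.symm)
  · intro hk'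
    have : homogeneousComponent k R = 0 := homogeneousComponent_eq_zero _ _ (by simpa using hk')
    rw [this, map_zero, map_zero]

theorem MvPolynomial.IsHomogeneous.aeval_mul_left {σ K L : Type*} [CommRing K] [CommRing L]
    [Algebra K L] {S : MvPolynomial σ K} {k : ℕ} (hS : S.IsHomogeneous k) (s : L) (x : σ → L) :
    MvPolynomial.aeval (fun i => s * x i) S = s ^ k * MvPolynomial.aeval x S := by
  rw [S.as_sum, map_sum, map_sum, Finset.mul_sum]
  refine Finset.sum_congr rfl fun m hm => ?_
  have hk : m.degree = k := by
    by_contra hne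
    exact (mem_support_iff.1 hm) (hS.coeff_eq_zero hne)
  simp only [aeval_monomial, ← hk, mul_pow, Finsupp.prod, Finset.prod_mul_distrib,
    Finset.prod_pow_eq_pow_sum, Finsupp.degree_apply]
  ring

theorem MvPolynomial.IsHomogeneous.aeval_pair {K L : Type*} [CommRing K] [Field L]
    [Algebra K L] {S : MvPolynomial (Fin 2) K} {k : ℕ} (hS : S.IsHomogeneous k) (x y : L)
    (hy : y ≠ 0) :
    MvPolynomial.aeval ![x, y] S = y ^ k * Polynomial.aeval (x / y)
      (MvPolynomial.aeval ![(Polynomial.X : Polynomial K), 1] S) := by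
  have h1 : (Polynomial.aeval (x / y)).comp
      (MvPolynomial.aeval ![(Polynomial.X : Polynomial K), 1]) =
      (MvPolynomial.aeval ![x / y, 1] : MvPolynomial (Fin 2) K →ₐ[K] L) := by
    apply MvPolynomial.algHom_ext
    intro i
    fin_cases i <;> simp
  rw [← AlgHom.comp_apply, h1, ← hS.aeval_mul_left]
  congr 2
  ext i
  fin_cases i <;> simp [mul_div_cancel₀ _ hy]

/-- Two elements of a domain over an algebraically closed field which satisfy a homogeneous
relation are proportional. -/
theorem MvPolynomial.IsHomogeneous.eq_smul_of_aeval_eq_zero {K Q : Type*} [Field K]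
    [IsAlgClosed K] [CommRing Q] [IsDomain Q] [Algebra K Q] {S : MvPolynomial (Fin 2) K} {k : ℕ}
    (hS : S.IsHomogeneous k) (hS0 : S ≠ 0) {b c : Q} (hc : c ≠ 0)
    (h : MvPolynomial.aeval ![b, c] S = 0) : ∃ r : K, b = r • c := by
  let P : Polynomial K := MvPolynomial.aeval ![Polynomial.X, 1] S
  have hP : P ≠ 0 := by
    intro hP
    -- The factor `X 1` takes care of the points with second coordinate 0, which dehomogenization
    -- does not see.
    have hz : S * X 1 = 0 := by
      have : Infinite K := IsAlgClosed.instInfinite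
      apply MvPolynomial.funext
      intro x
      rw [map_mul, eval_X, map_zero]
      by_cases hx : x 1 = 0
      · rw [hx, mul_zero]
      · have h1 := hS.aeval_pair (x 0) (x 1) hx
        change _ = _ * Polynomial.aeval _ P at h1
        have h2 : ![x 0, x 1] = x := by ext i; fin_cases i <;> rfl
        rw [hP, map_zero, mul_zero, h2] at h1
        rw [← MvPolynomial.coe_aeval_eq_eval, RingHom.coe_coe, h1, zero_mul]
    rcases mul_eq_zero.1 hz with h | h
    · exact hS0 h
    · exact X_ne_zero _ h
  let ι := algebraMap Q (FractionRing Q)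
  have hι : Function.Injective ι := IsFractionRing.injective _ _
  have hc' : ι c ≠ 0 := fun h0 => hc (hι (by rw [h0, map_zero]))
  have h0 : Polynomial.aeval (ι b / ι c) P = 0 := by
    have h1 := hS.aeval_pair (ι b) (ι c) hc'
    have h2 : MvPolynomial.aeval ![ι b, ι c] S = 0 := by
      have h3 := MvPolynomial.aeval_algebraMap_apply (B := FractionRing Q) ![b, c] S
      rw [h, map_zero] at h3
      rw [← h3]
      congr 2
      ext i; fin_cases i <;> rfl
    rw [h2] at h1
    exact (mul_eq_zero.1 h1.symm).resolve_left (pow_ne_zero _ hc')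
  have hs := IsAlgClosed.splits P
  obtain ⟨r, hr⟩ : ∃ r : K, ι b / ι c = algebraMap K _ r := by
    obtain ⟨r, hr⟩ := hs.mem_range_of_isRoot (f := P) hP (i := algebraMap K (FractionRing Q))
      (x := ι b / ι c) (by rwa [Polynomial.IsRoot, Polynomial.eval_map_algebraMap])
    exact ⟨r, hr.symm⟩
  refine ⟨r, hι ?_⟩
  rw [div_eq_iff hc', IsScalarTower.algebraMap_apply K Q] at hr
  rw [hr, Algebra.smul_def, map_mul]

/-- Cancel the largest power of the first variable from R, which is allowed as A ≠ 0, and reduce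
modulo f. A nonzero binary form then relates B and D, so B ≡ r D modulo f with r constant.
Evaluation at z forces r = 0. -/
theorem MvPolynomial.dvd_of_aeval_triple_eq_zero {σ K : Type*} [Field K] [IsAlgClosed K]
    {A B D f : MvPolynomial σ K} {z : σ → K} {k : ℕ} {R : MvPolynomial (Fin 3) K}
    (hf : Prime f) (hfA : f ∣ A) (hA : A ≠ 0) (hfz : eval z f = 0) (hB : eval z B = 0)
    (hD : eval z D ≠ 0) (hR : R.IsHomogeneous k) (hR0 : R ≠ 0)
    (h : MvPolynomial.aeval ![A, B, D] R = 0) : f ∣ B := by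
  let R' := finSuccEquiv K 2 R
  have hR' : R' ≠ 0 := by simpa [R'] using hR0
  obtain ⟨S, hS⟩ : Polynomial.X ^ R'.natTrailingDegree ∣ R' :=
    Polynomial.X_pow_dvd_iff.2 fun d hd => Polynomial.coeff_eq_zero_of_lt_natTrailingDegree hd
  have hS0 : S.coeff 0 = R'.coeff R'.natTrailingDegree := by
    obtain ⟨e, he⟩ : ∃ e, e = R'.natTrailingDegree := ⟨_, rfl⟩
    rw [← he] at hS ⊢
    rw [hS, Polynomial.coeff_X_pow_mul', if_pos le_rfl, Nat.sub_self]
  have hS0' : S.coeff 0 ≠ 0 := by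
    rw [hS0]; exact mt Polynomial.trailingCoeff_eq_zero.1 hR'
  obtain ⟨j, hj⟩ : ∃ j, R'.natTrailingDegree + j = k := by
    refine Nat.exists_eq_add_of_le (le_trans ?_ (hR.totalDegree_le)) |>.imp fun _ h => h.symm
    refine (Polynomial.natTrailingDegree_le_natDegree _).trans ?_
    rw [natDegree_finSuccEquiv]
    exact degreeOf_le_totalDegree _ _
  have hSh : (S.coeff 0).IsHomogeneous j := by
    rw [hS0]; exact hR.finSuccEquiv_coeff_isHomogeneous _ _ hj
  let θ : Polynomial (MvPolynomial (Fin 2) K) →+* MvPolynomial σ K :=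
    Polynomial.eval₂RingHom (MvPolynomial.aeval ![B, D] : MvPolynomial (Fin 2) K →ₐ[K] _).toRingHom A
  have hθ : θ R' = MvPolynomial.aeval ![A, B, D] R := by
    have : θ.comp (finSuccEquiv K 2).toAlgHom.toRingHom =
        (MvPolynomial.aeval ![A, B, D] : MvPolynomial (Fin 3) K →ₐ[K] _).toRingHom := by
      apply MvPolynomial.ringHom_ext
      · intro r
        simp [θ, finSuccEquiv_apply]
      · intro i
        refine Fin.cases ?_ (fun i => ?_) i
        · simp [θ, finSuccEquiv_X_zero]
        · simp [θ, finSuccEquiv_X_succ]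
    exact congrArg (fun e => e R) this
  have hθS : θ S = 0 := by
    rw [h, hS, map_mul, map_pow] at hθ
    refine (mul_eq_zero.1 hθ).resolve_left (pow_ne_zero _ ?_)
    simpa [θ] using hA
  have hdvd : f ∣ MvPolynomial.aeval ![B, D] (S.coeff 0) := by
    rw [← Polynomial.X_mul_divX_add S, map_add, map_mul] at hθS
    have h1 : θ Polynomial.X = A := by simp [θ]
    have h2 : θ (Polynomial.C (S.coeff 0)) = MvPolynomial.aeval ![B, D] (S.coeff 0) := by simp [θ]
    rw [h1, h2] at hθS
    rw [← dvd_add_right (hfA.mul_right (θ S.divX)), hθS]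
    exact dvd_zero _
  let I := Ideal.span {f}
  have : I.IsPrime := (Ideal.span_singleton_prime hf.ne_zero).2 hf
  have hmem : ∀ p, Ideal.Quotient.mk I p = 0 ↔ f ∣ p := fun p => by
    rw [Ideal.Quotient.eq_zero_iff_mem, Ideal.mem_span_singleton]
  have hz : ∀ p, f ∣ p → eval z p = 0 := by
    rintro _ ⟨q, rfl⟩
    rw [map_mul, hfz, zero_mul]
  have hq : MvPolynomial.aeval ![Ideal.Quotient.mk I B, Ideal.Quotient.mk I D] (S.coeff 0) = 0 := by
    rw [← (hmem _).2 hdvd]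
    change _ = Ideal.Quotient.mkₐ K I _
    rw [← AlgHom.comp_apply, MvPolynomial.comp_aeval]
    congr 2
    ext i; fin_cases i <;> rfl
  obtain ⟨r, hr⟩ := hSh.eq_smul_of_aeval_eq_zero hS0' (fun h0 => hD (hz _ ((hmem _).1 h0))) hq
  have hr' : f ∣ B - r • D := by
    rw [← hmem, map_sub, hr, sub_eq_zero]
    exact (map_smul (Ideal.Quotient.mkₐ K I) r D).symm
  have hr0 : r = 0 := by
    have := hz _ hr'
    rw [map_sub, hB, zero_sub, neg_eq_zero, smul_eval] at this
    exact (mul_eq_zero.1 this).resolve_right hD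
  simpa [hr0] using hr'

/-! ### Prime factors, partial derivatives, restriction to lines -/

theorem MvPolynomial.exists_prime_dvd_of_eval_eq_zero {σ K : Type*} [Field K]
    {A : MvPolynomial σ K} {z : σ → K} (hA : A ≠ 0) (hz : eval z A = 0) :
    ∃ f, Prime f ∧ f ∣ A ∧ eval z f = 0 := by
  obtain ⟨s, hs, u, hu⟩ := UniqueFactorizationMonoid.exists_prime_factors A hA
  have hzs : eval z s.prod = 0 := by
    rw [← hu, map_mul] at hz
    exact (mul_eq_zero.1 hz).resolve_right (u.isUnit.map (eval z)).ne_zero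
  rw [map_multiset_prod, Multiset.prod_eq_zero_iff, Multiset.mem_map] at hzs
  obtain ⟨f, hf, hfz⟩ := hzs
  exact ⟨f, hs f hf, (Multiset.dvd_prod hf).trans ⟨u, hu.symm⟩, hfz⟩

theorem MvPolynomial.totalDegree_pderiv_lt {σ K : Type*} [CommRing K] {f : MvPolynomial σ K}
    {i : σ} (h : pderiv i f ≠ 0) : (pderiv i f).totalDegree < f.totalDegree := by
  classical
  have key : ∀ m ∈ (pderiv i f).support, m.degree + 1 ≤ f.totalDegree := by
    intro m hm
    rw [mem_support_iff, coeff_pderiv] at hm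
    have : (m + Finsupp.single i 1).degree ≤ f.totalDegree := by
      rw [Finsupp.degree_apply]
      exact le_totalDegree (mem_support_iff.2 fun h0 => hm (by rw [h0, zero_mul]))
    simpa using this
  obtain ⟨m, hm⟩ := ne_zero_iff.1 h
  have h1 := key m (mem_support_iff.2 hm)
  have : (pderiv i f).totalDegree ≤ f.totalDegree - 1 := by
    refine Finset.sup_le fun m hm => ?_
    have := key m hm
    rw [Finsupp.degree_apply] at this
    change ∑ x ∈ m.support, m x ≤ _
    omega
  omega

/-- The restriction of a polynomial to the line through `x` with direction `v`. -/
noncomputable def MvPolynomial.restrictLine {σ K : Type*} [CommRing K] (x v : σ → K) :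
    MvPolynomial σ K →ₐ[K] Polynomial K :=
  MvPolynomial.aeval fun i => Polynomial.C (x i) + Polynomial.X * Polynomial.C (v i)

theorem MvPolynomial.eval_restrictLine {σ K : Type*} [CommRing K] (x v : σ → K) (t : K)
    (f : MvPolynomial σ K) : (restrictLine x v f).eval t = eval (x + t • v) f := by
  have : (Polynomial.evalRingHom t).comp (restrictLine x v).toRingHom = eval (x + t • v) := by
    apply MvPolynomial.ringHom_ext
    · intro r; simp
    · intro i; simp [restrictLine]; ring
  exact congrArg (fun e => e f) this

theorem MvPolynomial.derivative_restrictLine {σ K : Type*} [CommRing K] [Fintype σ] (x v : σ → K)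
    (f : MvPolynomial σ K) :
    (restrictLine x v f).derivative = restrictLine x v (∑ i, v i • pderiv i f) := by
  classical
  induction f using MvPolynomial.induction_on with
  | C a =>
    simp [restrictLine]
  | add p q hp hq =>
    simp only [map_add, hp, hq, smul_add, Finset.sum_add_distrib]
  | mul_X p j hp =>
    have hX : restrictLine x v (X j) = Polynomial.C (x j) + Polynomial.X * Polynomial.C (v j) := by
      simp [restrictLine]
    have : ∑ i, v i • pderiv i (p * X j) = (∑ i, v i • pderiv i p) * X j + v j • p := by
      simp only [pderiv_mul, smul_add, Finset.sum_add_distrib, Finset.sum_mul, smul_mul_assoc]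
      congr 1
      rw [Finset.sum_eq_single j]
      · simp
      · intro i _ hij
        rw [pderiv_X_of_ne hij.symm, mul_zero, smul_zero]
      · simp
    rw [this, map_mul (restrictLine x v), Polynomial.derivative_mul, hp, map_add, map_mul, map_smul,
      hX]
    simp [Polynomial.smul_eq_C_mul]
    ring

/-! ### Polynomials constant along the lines x + tH(x) -/

namespace QuasiTrans

/-- `f` is constant along the line through `x` with direction `H x`, for every point `x`. -/
def IsInvariantAlong {n : ℕ} (H : PolyMap n ℂ) (f : MvPolynomial (Fin n) ℂ) : Prop :=
  ∀ (x : Fin n → ℂ) (t : ℂ), eval (x + t • fun i => eval x (H i)) f = eval x f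

theorem eval_bind₁ {σ τ K : Type*} [CommRing K] (x : τ → K) (G : σ → MvPolynomial τ K)
    (p : MvPolynomial σ K) : eval x (bind₁ G p) = eval (fun i => eval x (G i)) p :=
  eval₂Hom_bind₁ _ _ _ _

variable {n : ℕ} {H h : PolyMap n ℂ} {f g : MvPolynomial (Fin n) ℂ}

/-- The inverse property says H(x + H(x)) = H(x). Induction gives H(x + mH(x)) = H(x) for natural m,
and a polynomial in t with one value at infinitely many points is constant. -/
theorem IsQuasiTranslation.isInvariantAlong (hH : IsQuasiTranslation H) (i : Fin n) :
    IsInvariantAlong H (H i) := by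
  have h1 : ∀ (x : Fin n → ℂ) (i : Fin n),
      eval (x + fun j => eval x (H j)) (H i) = eval x (H i) := by
    intro x i
    have := congrFun hH i
    simp only [comp, idMap, Pi.sub_apply, map_sub, bind₁_X_right, Pi.add_apply] at this
    have h2 : bind₁ (idMap n ℂ + H) (H i) = H i := by
      rw [sub_eq_iff_eq_add, add_right_inj] at this
      exact this.symm
    have h3 := congrArg (eval x) h2
    rw [eval_bind₁] at h3
    have h4 : (fun i => eval x ((idMap n ℂ + H) i)) = x + fun j => eval x (H j) := by
      ext j
      simp [idMap]
    rwa [h4] at h3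
  intro x t
  have h2 : ∀ (m : ℕ) (i : Fin n),
      eval (x + (m : ℂ) • fun j => eval x (H j)) (H i) = eval x (H i) := by
    intro m
    induction m with
    | zero => intro i; simp
    | succ m ih =>
      intro i
      have := h1 (x + (m : ℂ) • fun j => eval x (H j)) i
      simp_rw [ih] at this
      rw [← this, Nat.cast_succ, add_smul, one_smul, add_assoc]
  have h3 : restrictLine x (fun j => eval x (H j)) (H i) = Polynomial.C (eval x (H i)) := by
    apply Polynomial.eq_of_infinite_eval_eq
    refine Set.Infinite.mono ?_ (Set.infinite_range_of_injective (Nat.cast_injective (R := ℂ)))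
    rintro _ ⟨m, rfl⟩
    simp only [Set.mem_ofPred_eq, eval_restrictLine, h2, Polynomial.eval_C]
  rw [← eval_restrictLine, h3, Polynomial.eval_C]

/-- It suffices to check invariance outside the zero set of a nonzero polynomial. -/
theorem IsInvariantAlong.of_forall_eval_ne_zero (hg : g ≠ 0)
    (hf : ∀ (x : Fin n → ℂ) (t : ℂ), eval x g ≠ 0 →
      eval (x + t • fun i => eval x (H i)) f = eval x f) : IsInvariantAlong H f := by
  intro x t
  let F := bind₁ (fun i => X i + C t * H i) f - f
  have hF : ∀ x, eval x F = eval (x + t • fun i => eval x (H i)) f - eval x f := by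
    intro x
    rw [map_sub, eval_bind₁]
    congr 2
    simp [Pi.add_def]
  have h0 : g * F = 0 := by
    apply MvPolynomial.funext
    intro x
    rw [map_mul, map_zero, hF]
    by_cases hx : eval x g = 0
    · rw [hx, zero_mul]
    · rw [hf x t hx, sub_self, mul_zero]
  have := hF x
  rwa [(mul_eq_zero.1 h0).resolve_left hg, map_zero, eq_comm, sub_eq_zero] at this

/-- On a line through a point where f g ≠ 0, the restriction of f divides a nonzero constant of
ℂ[t], so it is constant. -/
theorem IsInvariantAlong.of_mul_left (hfg : IsInvariantAlong H (f * g)) (hne : f * g ≠ 0) :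
    IsInvariantAlong H f := by
  refine of_forall_eval_ne_zero hne fun x t hx => ?_
  let v := fun i => eval x (H i)
  have h1 : restrictLine x v f * restrictLine x v g = Polynomial.C (eval x (f * g)) := by
    apply Polynomial.funext
    intro t
    rw [← map_mul, eval_restrictLine, hfg, Polynomial.eval_C]
  have h2 : IsUnit (restrictLine x v f) :=
    isUnit_of_mul_isUnit_left (h1 ▸ Polynomial.isUnit_C.2 (isUnit_iff_ne_zero.2 hx))
  obtain ⟨c, -, hc⟩ := Polynomial.isUnit_iff.1 h2
  have h3 := eval_restrictLine x v t f
  have h4 := eval_restrictLine x v 0 f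
  rw [← hc, Polynomial.eval_C] at h3 h4
  rw [← h3, h4, zero_smul, add_zero]

/-- Where g(x) ≠ 0, the directions H(x) and h(x) span the same line; only the parameter is rescaled.
-/
theorem IsInvariantAlong.of_eq_mul (hf : IsInvariantAlong H f) (hg : g ≠ 0)
    (hH : ∀ i, H i = g * h i) : IsInvariantAlong h f := by
  refine of_forall_eval_ne_zero hg fun x t hx => ?_
  have := hf x (t / eval x g)
  rw [← this]
  congr 2
  ext i
  simp [hH]
  field_simp

/-- Multiplying f(x + s⁻¹H(x)) = f(x) by s^d gives f(sx + H(x)) = s^d f(x) for s ≠ 0, hence for all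
s; take s = 0. -/
theorem IsInvariantAlong.eval_eq_zero {d : ℕ} (hf : IsInvariantAlong H f)
    (hd : f.IsHomogeneous d) (hd0 : d ≠ 0) (x : Fin n → ℂ) :
    eval (fun i => eval x (H i)) f = 0 := by
  let v := fun i => eval x (H i)
  have h1 : restrictLine v x f = Polynomial.C (eval x f) * Polynomial.X ^ d := by
    apply Polynomial.eq_of_infinite_eval_eq
    refine Set.Infinite.mono (s := {(0 : ℂ)}ᶜ) ?_ (Set.finite_singleton _).infinite_compl
    intro s hs
    have hs : s ≠ 0 := hs
    simp only [Set.mem_ofPred_eq, eval_restrictLine, Polynomial.eval_mul, Polynomial.eval_C,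
      Polynomial.eval_pow, Polynomial.eval_X]
    have h2 := hd.aeval_mul_left s (x + s⁻¹ • v)
    rw [MvPolynomial.aeval_eq_eval, MvPolynomial.aeval_eq_eval, hf x s⁻¹] at h2
    rw [mul_comm, ← h2]
    congr 2
    ext i
    simp [mul_add, hs]
    ring
  have h2 := eval_restrictLine v x 0 f
  rw [h1, zero_smul, add_zero] at h2
  rw [← h2]
  simp [hd0]

theorem IsInvariantAlong.sum_mul_pderiv_eq_zero (hf : IsInvariantAlong H f) :
    ∑ i, H i * pderiv i f = 0 := by
  apply MvPolynomial.funext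
  intro x
  let v := fun i => eval x (H i)
  have h1 : restrictLine x v f = Polynomial.C (eval x f) := by
    apply Polynomial.funext
    intro t
    rw [eval_restrictLine, hf, Polynomial.eval_C]
  have h2 := derivative_restrictLine x v f
  rw [h1, Polynomial.derivative_C] at h2
  have h3 := eval_restrictLine x v 0 (∑ i, v i • pderiv i f)
  rw [← h2, zero_smul, add_zero, Polynomial.eval_zero] at h3
  rw [map_zero, h3]
  simp [v]

theorem eval_add_smul_of_sum_smul_pderiv_eq_zero {v : Fin n → ℂ}
    (hf : ∑ i, v i • pderiv i f = 0) (x : Fin n → ℂ) (t : ℂ) :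
    eval (x + t • v) f = eval x f := by
  have h2 := derivative_restrictLine x v f
  rw [hf, map_zero] at h2
  have h1 := Polynomial.eq_C_of_derivative_eq_zero h2
  have h3 := eval_restrictLine x v t f
  have h4 := eval_restrictLine x v 0 f
  rw [h1, Polynomial.eval_C] at h3 h4
  rw [← h3, h4, zero_smul, add_zero]

theorem totalDegree_sum_smul_pderiv_lt {v : Fin n → ℂ} (h : ∑ i, v i • pderiv i f ≠ 0) :
    (∑ i, v i • pderiv i f).totalDegree < f.totalDegree := by
  have h1 : ∀ i, (v i • pderiv i f).totalDegree ≤ f.totalDegree - 1 := by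
    intro i
    refine (totalDegree_smul_le _ _).trans ?_
    by_cases h0 : pderiv i f = 0
    · simp [h0]
    · have := totalDegree_pderiv_lt h0
      omega
  have h2 : (∑ i, v i • pderiv i f).totalDegree ≤ f.totalDegree - 1 :=
    totalDegree_finsetSum_le fun i _ => h1 i
  have h3 : f.totalDegree ≠ 0 := by
    intro h0
    apply h
    refine Finset.sum_eq_zero fun i _ => ?_
    rw [totalDegree_eq_zero_iff_eq_C.1 h0, pderiv_C, smul_zero]
  omega

theorem eq_zero_of_dvd_of_totalDegree_lt {p q : MvPolynomial (Fin n) ℂ} (h : p ∣ q)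
    (hd : q ≠ 0 → q.totalDegree < p.totalDegree) : q = 0 := by
  by_contra hq
  obtain ⟨r, rfl⟩ := h
  have := hd hq
  rw [totalDegree_mul_of_isDomain (left_ne_zero_of_mul hq) (right_ne_zero_of_mul hq)] at this
  omega

/-- A prime invariant which divides all `2 × 2`-minors of `(v, H)`, but not all components of `H`,
is invariant under translations in the direction of `v`. -/
theorem IsInvariantAlong.eval_add_smul (hf : IsInvariantAlong H f) (hp : Prime f)
    {v : Fin n → ℂ} (hv : v ≠ 0) (hdvd : ∀ j k, f ∣ v j • H k - v k • H j)
    (hH : ∃ j, ¬ f ∣ H j) (x : Fin n → ℂ) (t : ℂ) : eval (x + t • v) f = eval x f := by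
  apply eval_add_smul_of_sum_smul_pderiv_eq_zero
  obtain ⟨i, hi⟩ := Function.ne_iff.1 hv
  have hi : v i ≠ 0 := hi
  -- Modulo f the vectors v and H are parallel, so the relation ∑ H_k ∂_k f = 0 passes to v, up to
  -- the factor H_i.
  have h1 : f ∣ H i * ∑ k, v k • pderiv k f := by
    have h2 : H i * ∑ k, v k • pderiv k f =
        v i • ∑ k, H k * pderiv k f - ∑ k, (v i • H k - v k • H i) * pderiv k f := by
      simp only [Finset.mul_sum, Finset.smul_sum, ← Finset.sum_sub_distrib]
      refine Finset.sum_congr rfl fun k _ => ?_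
      simp only [smul_eq_C_mul]
      ring
    rw [h2, hf.sum_mul_pderiv_eq_zero, smul_zero, zero_sub, dvd_neg]
    exact Finset.dvd_sum fun k _ => (hdvd i k).mul_right _
  rcases hp.dvd_or_dvd h1 with h2 | h2
  · obtain ⟨j, hj⟩ := hH
    refine absurd ?_ hj
    have h3 := (dvd_sub_left ((smul_eq_C_mul (H i) (v j)) ▸ h2.mul_left _)).1 (hdvd i j)
    have h4 : H j = C (v i)⁻¹ * (v i • H j) := by
      rw [smul_eq_C_mul, ← mul_assoc, ← C_mul, inv_mul_cancel₀ hi, C_1, one_mul]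
    rw [h4]
    exact h3.mul_left _
  · exact eq_zero_of_dvd_of_totalDegree_lt h2 totalDegree_sum_smul_pderiv_lt

end QuasiTrans

/-! ### Linear relations between the components of a reduced map -/

namespace QuasiTrans

variable {n k d : ℕ} {h : PolyMap n ℂ}

theorem eq_smul_of_not_algebraicIndependent {σ : Type*} {d : ℕ} (hd : d ≠ 0)
    {A B : MvPolynomial σ ℂ} (hA : A.IsHomogeneous d) (hB : B.IsHomogeneous d) (hB0 : B ≠ 0)
    (h : ¬ AlgebraicIndependent ℂ ![A, B]) : ∃ r : ℂ, A = r • B := by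
  obtain ⟨k, R, hR, hR0, hRA⟩ := exists_isHomogeneous_aeval_eq_zero hd
    (by intro i; fin_cases i; exacts [hA, hB]) h
  exact hR.eq_smul_of_aeval_eq_zero hR0 hB0 hRA

theorem isHomogeneous_linearCombination (hh : ∀ i, (h i).IsHomogeneous d) (l : Fin n → ℂ) :
    (Fintype.linearCombination ℂ h l).IsHomogeneous d := by
  rw [Fintype.linearCombination_apply]
  refine MvPolynomial.IsHomogeneous.sum _ _ _ fun i _ => ?_
  rw [smul_eq_C_mul]
  exact (hh i).C_mul _

theorem eval_linearCombination (x : Fin n → ℂ) (l : Fin n → ℂ) :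
    eval x (Fintype.linearCombination ℂ h l) = l ⬝ᵥ fun i => eval x (h i) := by
  simp [Fintype.linearCombination_apply, dotProduct]

/-- If the components of `h` have no common factor, then no `n` linear forms in `n + 1` variables
become algebraically independent under a substitution which annihilates `h`. -/
theorem not_algebraicIndependent_of_eq_zero {B : Type*} [CommRing B] [IsDomain B] [Algebra ℂ B]
    {h : PolyMap (k + 1) ℂ} (hgcd : ∀ c, (∀ i, c ∣ h i) → IsUnit c)
    (φ : MvPolynomial (Fin (k + 1)) ℂ →ₐ[ℂ] B) (hφ : ∀ i, φ (h i) = 0)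
    (l : Fin k → Fin (k + 1) → ℂ) :
    ¬ AlgebraicIndependent ℂ fun i => ∑ j, l i j • φ (X j) := by
  intro hind
  obtain ⟨p, hp, hdvd⟩ := exists_dvd_of_algebraicIndependent_linear φ l hind
  exact hp (hgcd p fun i => hdvd _ (hφ i))

/-- Substituting h into its own components gives 0, since these are homogeneous invariants of
positive degree. -/
theorem not_algebraicIndependent_linearCombination {h : PolyMap (k + 1) ℂ}
    (hgcd : ∀ c, (∀ i, c ∣ h i) → IsUnit c) (hd : d ≠ 0) (hh : ∀ i, (h i).IsHomogeneous d)
    (hinv : ∀ i, IsInvariantAlong h (h i)) (l : Fin k → Fin (k + 1) → ℂ) :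
    ¬ AlgebraicIndependent ℂ fun i => Fintype.linearCombination ℂ h (l i) := by
  have := not_algebraicIndependent_of_eq_zero hgcd (MvPolynomial.aeval h) (by
    intro i
    apply MvPolynomial.funext
    intro x
    rw [map_zero]
    exact (eval_bind₁ x h (h i)).trans ((hinv i).eval_eq_zero (hh i) hd x)) l
  simpa [Fintype.linearCombination_apply] using this

/-- If any two components of `h` in a subspace of dimension at least `3` are proportional,
then two independent linear forms vanish on `h`. -/
theorem exists_linearIndependent_pair {M : Type*} [AddCommGroup M] [Module ℂ M]
    (L : (Fin n → ℂ) →ₗ[ℂ] M) (V : Submodule ℂ (Fin n → ℂ)) (hV : 3 ≤ Module.finrank ℂ V)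
    (hL : ∀ l ∈ V, ∀ l' ∈ V, L l' ≠ 0 → ∃ r : ℂ, L l = r • L l') :
    ∃ l : Fin 2 → Fin n → ℂ, LinearIndependent ℂ l ∧ ∀ i, L (l i) = 0 := by
  let L' := L.domRestrict V
  have hr : Module.finrank ℂ (LinearMap.range L') ≤ 1 := by
    by_cases h0 : ∃ l', L' l' ≠ 0
    · obtain ⟨l', hl'⟩ := h0
      refine finrank_le_one (⟨L' l', l', rfl⟩ : LinearMap.range L') ?_
      rintro ⟨_, l, rfl⟩
      obtain ⟨r, hr⟩ := hL l l.2 l' l'.2 hl'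
      exact ⟨r, Subtype.ext hr.symm⟩
    · push Not at h0
      have : L' = 0 := LinearMap.ext h0
      rw [this, LinearMap.range_zero, finrank_bot]
      exact zero_le_one
  have hk := LinearMap.finrank_range_add_finrank_ker L'
  let K : Submodule ℂ (Fin n → ℂ) := (LinearMap.ker L').map V.subtype
  have hk2 : 2 ≤ Module.finrank ℂ K := by
    rw [Submodule.finrank_map_subtype_eq]
    omega
  refine ⟨fun i => (Module.finBasis ℂ K (Fin.castLE hk2 i) : Fin n → ℂ), ?_, fun i => ?_⟩
  · exact ((Module.finBasis ℂ K).linearIndependent.comp _ (Fin.castLE_injective hk2)).map'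
      K.subtype K.ker_subtype
  · obtain ⟨l, hl, hl'⟩ := (Module.finBasis ℂ K (Fin.castLE hk2 i)).2
    beta_reduce
    rw [← hl']
    exact hl

theorem IsHomogeneousMap.exists_reduced {H : PolyMap n ℂ} (hH : IsHomogeneousMap H)
    (hinv : ∀ i, IsInvariantAlong H (H i)) (hH0 : H ≠ 0) :
    ∃ (g : MvPolynomial (Fin n) ℂ) (h : PolyMap n ℂ) (d : ℕ), (∀ i, H i = g * h i) ∧
      (∀ c, (∀ i, c ∣ h i) → IsUnit c) ∧ (∀ i, (h i).IsHomogeneous d) ∧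
      ∀ i, IsInvariantAlong h (h i) := by
  obtain ⟨g, h, hg, hgh, hgcd⟩ := exists_eq_mul_of_ne_zero H hH0
  obtain ⟨D, hD⟩ := hH
  have hgD : g.totalDegree ≤ D := by
    obtain ⟨i, hi⟩ := Function.ne_iff.1 hH0
    have hi : g * h i ≠ 0 := hgh i ▸ hi
    have := (hD i).totalDegree (hgh i ▸ hi)
    rw [hgh, totalDegree_mul_of_isDomain hg (right_ne_zero_of_mul hi)] at this
    omega
  have hghom : g.IsHomogeneous g.totalDegree := by
    obtain ⟨i, hi⟩ := Function.ne_iff.1 hH0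
    have hi : g * h i ≠ 0 := hgh i ▸ hi
    obtain ⟨m, hm⟩ := IsHomogeneous.of_mul_left (hgh i ▸ hD i) hi
    rwa [hm.totalDegree hg]
  -- The truncated subtraction is a true one by `hgD`.
  refine ⟨g, h, D - g.totalDegree, hgh, hgcd, fun i => ?_, fun i => ?_⟩
  · by_cases hi : h i = 0
    · rw [hi]; exact isHomogeneous_zero _ _ _
    have hne : h i * g ≠ 0 := mul_ne_zero hi hg
    have hmul : (h i * g).IsHomogeneous D := by rw [mul_comm, ← hgh]; exact hD i
    obtain ⟨m, hm⟩ := IsHomogeneous.of_mul_left hmul hne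
    have := (hm.mul hghom).inj_right hmul hne
    rwa [← this, Nat.add_sub_cancel]
  · by_cases hi : h i = 0
    · intro x t; rw [hi, map_zero, map_zero]
    have hne : h i * g ≠ 0 := mul_ne_zero hi hg
    refine IsInvariantAlong.of_eq_mul (IsInvariantAlong.of_mul_left (g := g) ?_ hne) hg hgh
    rw [mul_comm, ← hgh]
    exact hinv i

theorem exists_eq_smul_of_isHomogeneous_zero {L L' : MvPolynomial (Fin n) ℂ}
    (hL : L.IsHomogeneous 0) (hL' : L'.IsHomogeneous 0) (h0 : L' ≠ 0) : ∃ r : ℂ, L = r • L' := by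
  rw [← totalDegree_zero_iff_isHomogeneous, totalDegree_eq_zero_iff_eq_C] at hL hL'
  rw [hL'] at h0
  have : coeff 0 L' ≠ 0 := fun h => h0 (by rw [h, C_0])
  generalize coeff 0 L' = b at hL' this
  refine ⟨coeff 0 L / b, ?_⟩
  rw [hL', smul_eq_C_mul, ← C_mul, div_mul_cancel₀ _ this]
  exact hL

/-- Any two linear combinations of the components are algebraically dependent, hence proportional,
so the components span at most a line. -/
theorem exists_linearIndependent_pair_of_reduced_three {h : PolyMap 3 ℂ} {d : ℕ}
    (hgcd : ∀ c, (∀ i, c ∣ h i) → IsUnit c) (hh : ∀ i, (h i).IsHomogeneous d)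
    (hinv : ∀ i, IsInvariantAlong h (h i)) :
    ∃ l : Fin 2 → Fin 3 → ℂ, LinearIndependent ℂ l ∧
      ∀ i, Fintype.linearCombination ℂ h (l i) = 0 := by
  refine exists_linearIndependent_pair _ ⊤ (by simp) fun l _ l' _ hl' => ?_
  have h1 := isHomogeneous_linearCombination hh l
  have h2 := isHomogeneous_linearCombination hh l'
  rcases eq_or_ne d 0 with rfl | hd
  · exact exists_eq_smul_of_isHomogeneous_zero h1 h2 hl'
  refine eq_smul_of_not_algebraicIndependent hd h1 h2 hl' ?_
  convert not_algebraicIndependent_linearCombination hgcd hd hh hinv ![l, l'] using 2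
  ext i
  fin_cases i <;> rfl

/-- The fibre of `h` through `z` contains a hypersurface, the cone over the image of `h` with
vertex `h z`. -/
theorem exists_prime_dvd_linearCombination {h : PolyMap 4 ℂ} {d : ℕ}
    (hgcd : ∀ c, (∀ i, c ∣ h i) → IsUnit c) (hd : d ≠ 0) (hh : ∀ i, (h i).IsHomogeneous d)
    (hinv : ∀ i, IsInvariantAlong h (h i)) {v z : Fin 4 → ℂ} (hz : (fun i => eval z (h i)) = v)
    (hv : v ≠ 0) {l₁ : Fin 4 → ℂ} (hl₁ : l₁ ⬝ᵥ v = 0)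
    (hl₁' : Fintype.linearCombination ℂ h l₁ ≠ 0) :
    ∃ f : MvPolynomial (Fin 4) ℂ,
      (∀ l, l ⬝ᵥ v = 0 → f ∣ Fintype.linearCombination ℂ h l) ∧
      ∀ (y : Fin 4 → ℂ) (s t : ℂ), eval (s • (fun i => eval y (h i)) + t • v) f = 0 := by
  obtain ⟨f, hf, hfA, hfz⟩ := exists_prime_dvd_of_eval_eq_zero (z := z) hl₁' (by
    rw [eval_linearCombination, hz, hl₁])
  obtain ⟨i₀, hi₀⟩ := Function.ne_iff.1 hv
  have hi₀ : v i₀ ≠ 0 := hi₀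
  have hdvd : ∀ l, l ⬝ᵥ v = 0 → f ∣ Fintype.linearCombination ℂ h l := by
    intro l hl
    -- The forms `l₁` and `l` vanish at v while coordinate `i₀` does not; these are the roles of A,
    -- B, D in `dvd_of_aeval_triple_eq_zero`.
    have hdep := not_algebraicIndependent_linearCombination hgcd hd hh hinv
      ![l₁, l, Pi.single i₀ 1]
    obtain ⟨k, R, hR, hR0, hRA⟩ := exists_isHomogeneous_aeval_eq_zero hd
      (fun i => isHomogeneous_linearCombination hh _) hdep
    refine dvd_of_aeval_triple_eq_zero (D := Fintype.linearCombination ℂ h (Pi.single i₀ 1))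
      hf hfA hl₁' hfz ?_ ?_ hR hR0 ?_
    · rw [eval_linearCombination, hz, hl]
    · rw [eval_linearCombination, hz]
      simpa using hi₀
    · rw [← hRA]
      congr 2
      ext i
      fin_cases i <;> rfl
  obtain ⟨q, hq⟩ := hfA
  have hhom := isHomogeneous_linearCombination hh l₁
  rw [hq] at hhom hl₁'
  obtain ⟨m, hm⟩ := IsHomogeneous.of_mul_left hhom hl₁'
  have hinvl : IsInvariantAlong h (f * q) := by
    intro x t
    rw [← hq, eval_linearCombination, eval_linearCombination]
    congr 1
    ext i
    exact hinv i x t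
  have hinvf : IsInvariantAlong h f := hinvl.of_mul_left hl₁'
  have hm0 : m ≠ 0 := by
    rintro rfl
    rw [← totalDegree_zero_iff_isHomogeneous, totalDegree_eq_zero_iff_eq_C] at hm
    rw [hm, eval_C] at hfz
    exact hf.ne_zero (by rw [hm, hfz, C_0])
  refine ⟨f, hdvd, fun y s t => ?_⟩
  -- Translation by t v does not change f, and f vanishes at s h(y) by homogeneity and invariance.
  rw [hinvf.eval_add_smul hf hv]
  · have h1 := hm.aeval_mul_left s fun i => eval y (h i)
    rw [MvPolynomial.aeval_eq_eval, MvPolynomial.aeval_eq_eval, hinvf.eval_eq_zero hm hm0,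
      mul_zero] at h1
    exact h1
  · intro j k
    have := hdvd (v j • Pi.single k 1 - v k • Pi.single j 1) (by
      simp [sub_dotProduct, mul_comm])
    simpa [Fintype.linearCombination_apply_single] using this
  · by_contra! hall
    exact hf.not_isUnit (hgcd f hall)

end QuasiTrans

/-! ### The relations in dimension four -/

namespace QuasiTrans

/-- Serves to show that the cone with vertex v has one dimension more than the projection from v. -/
theorem algebraicIndependent_X_C_pair {σ : Type*} {A B : MvPolynomial σ ℂ}
    (h : AlgebraicIndependent ℂ ![A, B]) :
    AlgebraicIndependent ℂ ![(Polynomial.X : Polynomial (MvPolynomial σ ℂ)), Polynomial.C A,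
      Polynomial.C B] := by
  have h1 : (MvPolynomial.aeval ![(Polynomial.X : Polynomial (MvPolynomial σ ℂ)), Polynomial.C A,
      Polynomial.C B] : MvPolynomial (Fin 3) ℂ →ₐ[ℂ] _).toRingHom =
      (Polynomial.mapRingHom (MvPolynomial.aeval ![A, B] :
        MvPolynomial (Fin 2) ℂ →ₐ[ℂ] _).toRingHom).comp (finSuccEquiv ℂ 2).toAlgHom.toRingHom := by
    apply MvPolynomial.ringHom_ext
    · intro r
      simp [finSuccEquiv_apply]
    · intro i
      refine Fin.cases ?_ (fun i => ?_) i
      · simp [finSuccEquiv_X_zero]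
      · have h2 := finSuccEquiv_X_succ (R := ℂ) (j := i)
        rw [RingHom.comp_apply]
        change _ = Polynomial.map _ (MvPolynomial.finSuccEquiv ℂ 2 (X i.succ))
        rw [h2]
        fin_cases i <;> simp
  have h2 := (Polynomial.map_injective _ h).comp (finSuccEquiv ℂ 2).injective
  intro p q hpq
  apply h2
  have hp := congrArg (fun e => e p) h1
  have hq := congrArg (fun e => e q) h1
  exact hp.symm.trans (Eq.trans hpq hq)

theorem polynomial_eq_zero_of_eval_eval {σ : Type*} (Q : Polynomial (MvPolynomial σ ℂ))
    (h : ∀ (y : σ → ℂ) (t : ℂ), eval y (Q.eval (C t)) = 0) : Q = 0 := by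
  apply Polynomial.eq_zero_of_infinite_isRoot
  refine Set.Infinite.mono ?_ (Set.infinite_range_of_injective (C_injective σ ℂ))
  rintro _ ⟨t, rfl⟩
  apply MvPolynomial.funext
  intro y
  rw [h, map_zero]

/-- The forms v_i e_k - v_k e_i are orthogonal to v, so all 2 × 2 minors of (v, h(p)) vanish. -/
theorem exists_eq_smul_of_dvd_linearCombination {h : PolyMap 4 ℂ} {v p : Fin 4 → ℂ} (hv : v ≠ 0)
    {f : MvPolynomial (Fin 4) ℂ} (hf : ∀ l, l ⬝ᵥ v = 0 → f ∣ Fintype.linearCombination ℂ h l)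
    (hp : eval p f = 0) : ∃ r : ℂ, (fun i => eval p (h i)) = r • v := by
  obtain ⟨i₀, hi₀⟩ := Function.ne_iff.1 hv
  have hi₀ : v i₀ ≠ 0 := hi₀
  refine ⟨eval p (h i₀) / v i₀, ?_⟩
  ext k
  obtain ⟨q, hq⟩ := hf (v i₀ • Pi.single k 1 - v k • Pi.single i₀ 1) (by
    simp [sub_dotProduct, mul_comm])
  have := eval_linearCombination (h := h) p (v i₀ • Pi.single k 1 - v k • Pi.single i₀ 1)
  rw [hq, map_mul, hp, zero_mul] at this
  simp [sub_dotProduct] at this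
  simp only [Pi.smul_apply, smul_eq_mul]
  field_simp
  linear_combination -this

theorem exists_linearIndependent_pair_of_reduced_four {h : PolyMap 4 ℂ} {d : ℕ}
    (hgcd : ∀ c, (∀ i, c ∣ h i) → IsUnit c) (hh : ∀ i, (h i).IsHomogeneous d)
    (hinv : ∀ i, IsInvariantAlong h (h i)) :
    ∃ l : Fin 2 → Fin 4 → ℂ, LinearIndependent ℂ l ∧
      ∀ i, Fintype.linearCombination ℂ h (l i) = 0 := by
  rcases eq_or_ne d 0 with rfl | hd
  · refine exists_linearIndependent_pair _ ⊤ (by simp) fun l _ l' _ hl' => ?_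
    exact exists_eq_smul_of_isHomogeneous_zero (isHomogeneous_linearCombination hh l)
      (isHomogeneous_linearCombination hh l') hl'
  -- The forms orthogonal to v make up a space of dimension at least 3, enough for
  -- `exists_linearIndependent_pair`.
  suffices hV : ∃ v : Fin 4 → ℂ, ∀ l, l ⬝ᵥ v = 0 → ∀ l', l' ⬝ᵥ v = 0 →
      Fintype.linearCombination ℂ h l' ≠ 0 →
      ∃ r : ℂ, Fintype.linearCombination ℂ h l = r • Fintype.linearCombination ℂ h l' by
    obtain ⟨v, hv⟩ := hV
    refine exists_linearIndependent_pair _ (LinearMap.ker (Fintype.linearCombination ℂ v)) ?_ hv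
    have h1 := LinearMap.finrank_range_add_finrank_ker (Fintype.linearCombination ℂ v)
    have h2 := Submodule.finrank_le (LinearMap.range (Fintype.linearCombination ℂ v))
    simp only [Module.finrank_self, Module.finrank_fintype_fun_eq_card, Fintype.card_fin] at h1 h2
    omega
  by_cases hdeg : ∃ v : Fin 4 → ℂ, v ≠ 0 ∧ ∀ l, l ⬝ᵥ v = 0 → Fintype.linearCombination ℂ h l = 0
  · obtain ⟨v, -, hv⟩ := hdeg
    exact ⟨v, fun l _ l' hl' h0 => absurd (hv l' hl') h0⟩
  push Not at hdeg
  obtain ⟨z, hz⟩ : ∃ z : Fin 4 → ℂ, (fun i => eval z (h i)) ≠ 0 := by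
    by_contra! hall
    refine not_isUnit_zero (hgcd 0 fun i => ?_)
    rw [zero_dvd_iff]
    apply MvPolynomial.funext
    intro z
    rw [map_zero]
    exact congrFun (hall z) i
  set v := fun i => eval z (h i) with hvdef
  have hhv : ∀ i (s : ℂ), eval (s • v) (h i) = 0 := by
    intro i s
    have h1 := (hh i).aeval_mul_left s v
    rw [MvPolynomial.aeval_eq_eval, MvPolynomial.aeval_eq_eval] at h1
    change eval (fun i => s * v i) (h i) = 0
    rw [h1, (hinv i).eval_eq_zero (hh i) hd, mul_zero]
  obtain ⟨l₁, hl₁, hl₁'⟩ := hdeg v hz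
  obtain ⟨f, hf, hfv⟩ := exists_prime_dvd_linearCombination hgcd hd hh hinv hvdef.symm hz hl₁ hl₁'
  -- The point lies on the hypersurface for v and on the one for w = h(y), so h is parallel there to
  -- both. If w is itself a multiple of v, `hhv` applies.
  have hcone : ∀ (y : Fin 4 → ℂ) (t : ℂ) i, eval ((fun i => eval y (h i)) + t • v) (h i) = 0 := by
    intro y t i
    set w := fun i => eval y (h i) with hw
    by_cases hpar : ∃ c : ℂ, w = c • v
    · obtain ⟨c, hc⟩ := hpar
      rw [hc, ← add_smul]
      exact hhv i _
    have hw0 : w ≠ 0 := fun h0 => hpar ⟨0, by rw [h0, zero_smul]⟩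
    obtain ⟨l₂, hl₂, hl₂'⟩ := hdeg w hw0
    obtain ⟨f', hf', hfw⟩ :=
      exists_prime_dvd_linearCombination hgcd hd hh hinv hw.symm hw0 hl₂ hl₂'
    have hpf : eval (w + t • v) f = 0 := by simpa using hfv y 1 t
    have hpf' : eval (w + t • v) f' = 0 := by
      have := hfw z t 1
      rwa [one_smul, add_comm] at this
    obtain ⟨r, hr⟩ := exists_eq_smul_of_dvd_linearCombination hz hf hpf
    obtain ⟨r', hr'⟩ := exists_eq_smul_of_dvd_linearCombination hw0 hf' hpf'
    have hr0 : r' = 0 := by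
      by_contra h0
      refine hpar ⟨r'⁻¹ * r, ?_⟩
      rw [mul_smul, ← hr, hr', smul_smul, inv_mul_cancel₀ h0, one_smul]
    rw [hr0, zero_smul] at hr'
    exact congrFun hr' i
  obtain ⟨i₀, hi₀⟩ := Function.ne_iff.1 hz
  have hi₀ : v i₀ ≠ 0 := hi₀
  refine ⟨v, fun l hl l' hl' h0 => ?_⟩
  refine eq_smul_of_not_algebraicIndependent hd
    (isHomogeneous_linearCombination hh l) (isHomogeneous_linearCombination hh l') h0 fun hind => ?_
  -- The generic point of the cone, with its parameter shifted so that coordinate `i₀` becomes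
  -- v_{i₀} X. Then `Pi.single i₀ (v i₀)⁻¹` maps to X, and `l`, `l'` map to constants in X.
  let φ : MvPolynomial (Fin 4) ℂ →ₐ[ℂ] Polynomial (MvPolynomial (Fin 4) ℂ) :=
    MvPolynomial.aeval fun i => Polynomial.C (h i) +
      v i • (Polynomial.X - (v i₀)⁻¹ • Polynomial.C (h i₀))
  have hφ : ∀ i, φ (h i) = 0 := by
    intro i
    apply polynomial_eq_zero_of_eval_eval
    intro y t
    have h1 : ((eval y).comp (Polynomial.evalRingHom (C t))).comp φ.toRingHom =
        eval ((fun i => eval y (h i)) + (t - (v i₀)⁻¹ * eval y (h i₀)) • v) := by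
      apply MvPolynomial.ringHom_ext
      · intro r
        simp [φ, Polynomial.algebraMap_apply]
      · intro i
        simp [φ, mul_comm]
    exact (congrArg (fun e => e (h i)) h1).trans (hcone y _ i)
  refine not_algebraicIndependent_of_eq_zero hgcd φ hφ ![Pi.single i₀ (v i₀)⁻¹, l, l'] ?_
  have hlin : ∀ l : Fin 4 → ℂ, ∑ j, l j • φ (X j) =
      Polynomial.C (Fintype.linearCombination ℂ h l) +
        (l ⬝ᵥ v) • (Polynomial.X - (v i₀)⁻¹ • Polynomial.C (h i₀)) := by
    intro l
    simp only [φ, aeval_X, smul_add, Finset.sum_add_distrib, smul_smul, dotProduct,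
      Finset.sum_smul, Fintype.linearCombination_apply, map_sum, Polynomial.smul_C]
  have := algebraicIndependent_X_C_pair hind
  convert this using 1
  ext1 i
  fin_cases i
  · refine (hlin _).trans ?_
    simp [hi₀, Polynomial.smul_C]
  · refine (hlin _).trans ?_
    simp [hl]
  · refine (hlin _).trans ?_
    simp [hl']

end QuasiTrans

/-! ### Linear conjugation and normal forms -/

namespace QuasiTrans

variable {n : ℕ}

theorem notMem_vars_of_pderiv_eq_zero {σ : Type*} {f : MvPolynomial σ ℂ} {i : σ}
    (h : pderiv i f = 0) : i ∉ f.vars := by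
  classical
  intro hi
  obtain ⟨m, hm, him⟩ := (mem_vars_iff_mem_support i).1 hi
  have h1 : m = (m - Finsupp.single i 1) + Finsupp.single i 1 := by
    rw [tsub_add_cancel_of_le]
    rw [Finsupp.single_le_iff]
    exact Nat.one_le_iff_ne_zero.2 (Finsupp.mem_support_iff.1 him)
  have h2 := coeff_pderiv (i := i) f (m - Finsupp.single i 1)
  rw [← h1, h, coeff_zero] at h2
  rcases mul_eq_zero.1 h2.symm with h3 | h3
  · exact mem_support_iff.1 hm h3
  · exact Nat.cast_add_one_ne_zero _ h3

theorem mem_adjoin_pair_iff {σ : Type*} {f : MvPolynomial σ ℂ} {i j : σ} :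
    f ∈ Algebra.adjoin ℂ ({X i, X j} : Set (MvPolynomial σ ℂ)) ↔ ∀ k ∈ f.vars, k = i ∨ k = j := by
  have : ({X i, X j} : Set (MvPolynomial σ ℂ)) = X '' {i, j} := (Set.image_pair _ _ _).symm
  rw [this, ← supported_eq_adjoin_X, mem_supported]
  rfl

theorem linConj_eq (T : Matrix.GeneralLinearGroup (Fin n) ℂ) (H : PolyMap n ℂ) (i : Fin n) :
    linConj T H i =
      bind₁ (linMap T.val) (Fintype.linearCombination ℂ H ((T⁻¹).val i)) := by
  simp [linConj, comp, linMap, Fintype.linearCombination_apply, smul_eq_C_mul]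

theorem eval_linConj (T : Matrix.GeneralLinearGroup (Fin n) ℂ) (H : PolyMap n ℂ) (x : Fin n → ℂ) :
    (fun i => eval x (linConj T H i)) =
      (T⁻¹).val.mulVec fun j => eval (T.val.mulVec x) (H j) := by
  ext i
  rw [linConj_eq, eval_bind₁, eval_linearCombination]
  simp [linMap, Matrix.mulVec, dotProduct]
  rfl

theorem IsInvariantAlong.linConj {H : PolyMap n ℂ} (hH : ∀ i, IsInvariantAlong H (H i))
    (T : Matrix.GeneralLinearGroup (Fin n) ℂ) (i : Fin n) :
    IsInvariantAlong (linConj T H) (linConj T H i) := by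
  intro x t
  refine congrFun (f := fun i => eval _ (QuasiTrans.linConj T H i))
    (g := fun i => eval x (QuasiTrans.linConj T H i)) ?_ i
  simp only [eval_linConj, Matrix.mulVec_add, Matrix.mulVec_smul,
    Matrix.mulVec_mulVec, ← Units.val_mul, mul_inv_cancel, Units.val_one, Matrix.one_mulVec]
  congr 1
  ext j
  exact hH j _ t

/-- Complete the two relations to a basis and let its members be the rows of T⁻¹. -/
theorem exists_linConj_three {H : PolyMap 3 ℂ} {l : Fin 2 → Fin 3 → ℂ}
    (hl : LinearIndependent ℂ l) (hH : ∀ i, Fintype.linearCombination ℂ H (l i) = 0) :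
    ∃ T : Matrix.GeneralLinearGroup (Fin 3) ℂ, linConj T H 0 = 0 ∧ linConj T H 1 = 0 := by
  obtain ⟨v, hv⟩ := exists_linearIndependent_snoc_of_lt_finrank hl (by simp)
  obtain ⟨M, hM⟩ := exists_generalLinearGroup_of_linearIndependent hv
  refine ⟨M⁻¹, ?_, ?_⟩
  · have : M.val 0 = l 0 := funext (hM 0)
    rw [linConj_eq, inv_inv, this, hH, map_zero]
  · have : M.val 1 = l 1 := funext (hM 1)
    rw [linConj_eq, inv_inv, this, hH, map_zero]

theorem exists_linConj_four {H : PolyMap 4 ℂ} {l : Fin 2 → Fin 4 → ℂ}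
    (hl : LinearIndependent ℂ l) (hH : ∀ i, Fintype.linearCombination ℂ H (l i) = 0) :
    ∃ T : Matrix.GeneralLinearGroup (Fin 4) ℂ, linConj T H 0 = 0 ∧ linConj T H 1 = 0 := by
  obtain ⟨v, hv⟩ := exists_linearIndependent_snoc_of_lt_finrank hl (by simp)
  obtain ⟨w, hw⟩ := exists_linearIndependent_snoc_of_lt_finrank hv (by simp)
  obtain ⟨M, hM⟩ := exists_generalLinearGroup_of_linearIndependent hw
  refine ⟨M⁻¹, ?_, ?_⟩
  · have : M.val 0 = l 0 := funext (hM 0)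
    rw [linConj_eq, inv_inv, this, hH, map_zero]
  · have : M.val 1 = l 1 := funext (hM 1)
    rw [linConj_eq, inv_inv, this, hH, map_zero]

theorem linearCombination_eq_zero_of_eq_mul {H h : PolyMap n ℂ} {g : MvPolynomial (Fin n) ℂ}
    (hgh : ∀ i, H i = g * h i) {l : Fin n → ℂ} (hl : Fintype.linearCombination ℂ h l = 0) :
    Fintype.linearCombination ℂ H l = 0 := by
  rw [Fintype.linearCombination_apply] at hl ⊢
  simp_rw [hgh, ← mul_smul_comm, ← Finset.mul_sum, hl, mul_zero]

/-- If `p` is annihilated by the derivation `p ∂ᵢ + q ∂ⱼ` with `p` and `q` coprime, then both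
partial derivatives of `p` vanish. -/
theorem pderiv_eq_zero_of_isRelPrime {σ : Type*} {p q : MvPolynomial σ ℂ} {i j : σ}
    (hpq : IsRelPrime p q) (h : p * pderiv i p + q * pderiv j p = 0) :
    pderiv i p = 0 ∧ pderiv j p = 0 := by
  have h1 : p ∣ pderiv j p := by
    refine hpq.dvd_of_dvd_mul_left ?_
    rw [← dvd_add_right (dvd_mul_right p (pderiv i p)), h]
    exact dvd_zero _
  have h2 : pderiv j p = 0 := by
    by_contra h0
    obtain ⟨r, hr⟩ := h1
    have h3 := totalDegree_pderiv_lt h0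
    rw [hr] at h0
    rw [hr, totalDegree_mul_of_isDomain (left_ne_zero_of_mul h0) (right_ne_zero_of_mul h0)] at h3
    omega
  refine ⟨?_, h2⟩
  rw [h2, mul_zero, add_zero] at h
  rcases mul_eq_zero.1 h with h3 | h3
  · rw [h3, map_zero]
  · exact h3

theorem totalDegree_aeval_le {σ τ : Type*} {φ : σ → MvPolynomial τ ℂ}
    (hφ : ∀ i, (φ i).totalDegree ≤ 1) (p : MvPolynomial σ ℂ) :
    (MvPolynomial.aeval φ p).totalDegree ≤ p.totalDegree := by
  conv_lhs => rw [p.as_sum, map_sum]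
  refine totalDegree_finsetSum_le fun m hm => ?_
  rw [aeval_monomial, MvPolynomial.algebraMap_eq]
  refine (totalDegree_mul _ _).trans ?_
  rw [totalDegree_C, zero_add]
  refine (totalDegree_finsetProd _ _).trans (le_trans ?_ (le_totalDegree hm))
  refine Finset.sum_le_sum fun i _ => (totalDegree_pow _ _).trans ?_
  exact (Nat.mul_le_mul_left _ (hφ i)).trans (mul_one _).le

/-- The polynomial has degree one in `X i`, and its coefficients a and b X_j are coprime because X_j
does not divide a. -/
theorem irreducible_mul_X_add_mul_X {σ : Type*} {a b : MvPolynomial σ ℂ} {i j : σ}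
    (hab : IsRelPrime a b) (ha : a ≠ 0) (hij : i ≠ j) (hai : i ∉ a.vars) (haj : j ∉ a.vars)
    (hbi : i ∉ b.vars) : Irreducible (a * X i + b * X j) := by
  classical
  refine irreducible_mul_X_add _ _ _ ha hai ?_ ?_
  · intro h
    rcases Finset.mem_union.1 (vars_mul _ _ h) with h | h
    · exact hbi h
    · rw [vars_X, Finset.mem_singleton] at h
      exact hij h
  · refine IsRelPrime.mul_right hab (IsRelPrime.symm ?_)
    refine ((X_prime (i := j)).irreducible.isRelPrime_iff_not_dvd).2 ?_
    rintro ⟨c, rfl⟩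
    rw [mem_vars_iff_degreeOf_ne_zero, mul_comm,
      (degreeOf_mul_X_eq_degreeOf_add_one_iff j c).2 (right_ne_zero_of_mul ha)] at haj
    exact haj (Nat.succ_ne_zero _)

/-- The invariants of the derivation `b ∂₂ + a ∂₃` with `a`, `b` coprime polynomials in the first
two variables. -/
theorem mem_adjoin_of_isInvariantAlong {a b : MvPolynomial (Fin 4) ℂ} (hab : IsRelPrime a b)
    (ha2 : 2 ∉ a.vars) (ha3 : 3 ∉ a.vars) (hb2 : 2 ∉ b.vars) (hb3 : 3 ∉ b.vars)
    (N : ℕ) (g : MvPolynomial (Fin 4) ℂ) (hN : g.totalDegree ≤ N)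
    (hg : IsInvariantAlong ![0, 0, b, a] g) :
    g ∈ Algebra.adjoin ℂ ({X 0, X 1, a * X 2 - b * X 3} : Set (MvPolynomial (Fin 4) ℂ)) := by
  induction N using Nat.strong_induction_on generalizing g with
  | _ N ih =>
  set u := a * X 2 - b * X 3 with hu_def
  have hu : Irreducible u := by
    by_cases ha : a = 0
    · have hb : b ≠ 0 := by
        rintro rfl
        exact not_isUnit_zero (hab (ha ▸ dvd_refl (0 : MvPolynomial (Fin 4) ℂ)) dvd_rfl)
      have := irreducible_mul_X_add_mul_X hab.symm.neg_left (neg_ne_zero.2 hb)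
        (i := 3) (j := 2) (by decide) (by rwa [vars_neg]) (by rwa [vars_neg]) ha3
      convert this using 1
      rw [hu_def]
      ring
    · have := irreducible_mul_X_add_mul_X hab.neg_right ha
        (i := 2) (j := 3) (by decide) ha2 ha3 (by rwa [vars_neg])
      convert this using 1
      rw [hu_def]
      ring
  have hup : Prime u := hu.prime
  let g₀ : MvPolynomial (Fin 4) ℂ := bind₁ ![X 0, X 1, 0, 0] g
  have hg₀ : g₀ ∈ Algebra.adjoin ℂ ({X 0, X 1, u} : Set (MvPolynomial (Fin 4) ℂ)) := by
    have : g₀ ∈ (MvPolynomial.aeval ![X 0, X 1, 0, 0] :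
        MvPolynomial (Fin 4) ℂ →ₐ[ℂ] MvPolynomial (Fin 4) ℂ).range := ⟨g, rfl⟩
    rw [← Algebra.adjoin_range_eq_range_aeval] at this
    refine Algebra.adjoin_le ?_ this
    rintro _ ⟨i, rfl⟩
    fin_cases i
    · exact Algebra.subset_adjoin (by simp)
    · exact Algebra.subset_adjoin (by simp)
    · exact zero_mem _
    · exact zero_mem _
  -- Modulo u the vectors (x₂, x₃) and (b, a) are proportional, so over the fraction field of the
  -- quotient the flow carries (x₂, x₃) to (0, 0) without changing g.
  have hdvd : u ∣ g - g₀ := by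
    let I := Ideal.span {u}
    have : I.IsPrime := (Ideal.span_singleton_prime hup.ne_zero).2 hup
    let π : MvPolynomial (Fin 4) ℂ →ₐ[ℂ] FractionRing (MvPolynomial (Fin 4) ℂ ⧸ I) :=
      (IsScalarTower.toAlgHom ℂ (MvPolynomial (Fin 4) ℂ ⧸ I) _).comp (Ideal.Quotient.mkₐ ℂ I)
    have hπ : ∀ p, π p = 0 ↔ u ∣ p := fun p => by
      rw [← Ideal.mem_span_singleton, ← Ideal.Quotient.eq_zero_iff_mem]
      exact map_eq_zero_iff _
        (IsFractionRing.injective (MvPolynomial (Fin 4) ℂ ⧸ I) (FractionRing (MvPolynomial (Fin 4) ℂ ⧸ I)))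
    -- Invariance is an identity of polynomials in t, so t may be taken in any extension, here the
    -- fraction field.
    have hflow : ∀ t, MvPolynomial.aeval
        ![π (X 0), π (X 1), π (X 2) + t * π b, π (X 3) + t * π a] g = π g := by
      intro t
      let Ψ : MvPolynomial (Fin 4) ℂ →ₐ[ℂ] Polynomial (MvPolynomial (Fin 4) ℂ) :=
        MvPolynomial.aeval fun i =>
          Polynomial.C (X i) + Polynomial.X * Polynomial.C ((![0, 0, b, a] : PolyMap 4 ℂ) i)
      have hΨ : Ψ g = Polynomial.C g := by
        rw [← sub_eq_zero]
        apply polynomial_eq_zero_of_eval_eval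
        intro y s
        have h1 : ((eval y).comp (Polynomial.evalRingHom (C s))).comp Ψ.toRingHom =
            eval (y + s • fun i => eval y ((![0, 0, b, a] : PolyMap 4 ℂ) i)) := by
          apply MvPolynomial.ringHom_ext
          · intro r
            simp [Ψ, Polynomial.algebraMap_apply]
          · intro i
            simp [Ψ]
            ring
        have h2 : eval y ((Ψ g).eval (C s)) = _ := congrArg (fun e => e g) h1
        rw [Polynomial.eval_sub, map_sub, h2, Polynomial.eval_C, sub_eq_zero]
        exact hg y s
      have h3 : (Polynomial.eval₂RingHom π.toRingHom t).comp Ψ.toRingHom =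
          (MvPolynomial.aeval ![π (X 0), π (X 1), π (X 2) + t * π b, π (X 3) + t * π a] :
            MvPolynomial (Fin 4) ℂ →ₐ[ℂ] _).toRingHom := by
        apply MvPolynomial.ringHom_ext
        · intro r
          simp [Ψ, Polynomial.algebraMap_apply]
        · intro i
          fin_cases i <;> simp [Ψ, -Polynomial.X_mul_C]
      have h4 := congrArg (fun e => e g) h3
      refine h4.symm.trans ?_
      change Polynomial.eval₂RingHom π.toRingHom t (Ψ g) = _
      rw [hΨ]
      simp
    have hrel : π a * π (X 2) = π b * π (X 3) := by
      have := (hπ u).2 dvd_rfl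
      rwa [hu_def, map_sub, map_mul, map_mul, sub_eq_zero] at this
    obtain ⟨t, ht2, ht3⟩ : ∃ t, π (X 2) + t * π b = 0 ∧ π (X 3) + t * π a = 0 := by
      by_cases ha : π a = 0
      · have hb : π b ≠ 0 := fun hb => hu.not_isUnit (hab ((hπ a).1 ha) ((hπ b).1 hb))
        rw [ha, zero_mul, zero_eq_mul] at hrel
        refine ⟨-π (X 2) / π b, ?_, ?_⟩
        · field_simp
          ring
        · rw [ha, mul_zero, add_zero]
          exact hrel.resolve_left hb
      · refine ⟨-π (X 3) / π a, ?_, ?_⟩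
        · field_simp
          linear_combination hrel
        · field_simp
          ring
    rw [← hπ, map_sub, sub_eq_zero, ← hflow t, ht2, ht3]
    refine Eq.trans ?_ (MvPolynomial.comp_aeval_apply (f := ![X 0, X 1, 0, 0]) π g).symm
    congr 2
    ext i
    fin_cases i <;> simp
  obtain ⟨q, hq⟩ := hdvd
  have hgq : g = g₀ + u * q := by rw [← hq]; ring
  by_cases h0 : u * q = 0
  · rw [hgq, h0, add_zero]
    exact hg₀
  -- Since g₀ involves only x₀ and x₁ it is invariant, so g - g₀ and its factor q are too. As u is
  -- not constant, q has smaller degree and induction applies.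
  have hinv : IsInvariantAlong ![0, 0, b, a] (q * u) := by
    intro x t
    rw [mul_comm q u, ← hq, map_sub, map_sub, hg x t]
    congr 1
    rw [eval_bind₁, eval_bind₁]
    congr 2
    ext i
    fin_cases i <;> simp
  have hdeg : (u * q).totalDegree ≤ N := by
    rw [← hq]
    refine (totalDegree_sub _ _).trans (max_le hN (le_trans ?_ hN))
    refine totalDegree_aeval_le (fun i => ?_) g
    fin_cases i <;> simp
  rw [totalDegree_mul_of_isDomain (left_ne_zero_of_mul h0) (right_ne_zero_of_mul h0)] at hdeg
  have hu1 : u.totalDegree ≠ 0 := by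
    intro hu0
    rw [totalDegree_eq_zero_iff_eq_C] at hu0
    refine hu.not_isUnit (hu0 ▸ (isUnit_iff_ne_zero.2 fun hc => hu.ne_zero ?_).map C)
    rw [hu0, hc, C_0]
  rw [hgq]
  refine add_mem hg₀ (mul_mem (Algebra.subset_adjoin (by simp)) ?_)
  exact ih q.totalDegree (by omega) q le_rfl (hinv.of_mul_left (mul_comm u q ▸ h0))

/-- Removing the common factor g leaves h = (0, 0, b, a) with a, b coprime. Both are killed by b ∂₂
+ a ∂₃, which by coprimality and degree forces their partial derivatives in x₂ and x₃ to vanish. The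
factor g is invariant along h. -/
theorem exists_normal_form_four {G : PolyMap 4 ℂ} (hG : ∀ i, IsInvariantAlong G (G i))
    (h0 : G 0 = 0) (h1 : G 1 = 0) :
    ∃ a ∈ Algebra.adjoin ℂ ({X 0, X 1} : Set (MvPolynomial (Fin 4) ℂ)),
    ∃ b ∈ Algebra.adjoin ℂ ({X 0, X 1} : Set (MvPolynomial (Fin 4) ℂ)),
    ∃ g ∈ Algebra.adjoin ℂ ({X 0, X 1, a * X 2 - b * X 3} : Set (MvPolynomial (Fin 4) ℂ)),
      G = ![0, 0, b * g, a * g] := by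
  by_cases hG0 : G = 0
  · refine ⟨0, zero_mem _, 0, zero_mem _, 0, zero_mem _, ?_⟩
    rw [hG0]
    ext1 i
    fin_cases i <;> simp
  obtain ⟨g, h, hg, hgh, hgcd⟩ := exists_eq_mul_of_ne_zero G hG0
  have hh0 : h 0 = 0 := by
    have := hgh 0
    rw [h0, zero_eq_mul] at this
    exact this.resolve_left hg
  have hh1 : h 1 = 0 := by
    have := hgh 1
    rw [h1, zero_eq_mul] at this
    exact this.resolve_left hg
  have hinv : ∀ i, IsInvariantAlong h (h i) := by
    intro i
    by_cases hi : h i = 0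
    · intro x t; rw [hi, map_zero, map_zero]
    · refine IsInvariantAlong.of_eq_mul (IsInvariantAlong.of_mul_left (g := g) ?_
        (mul_ne_zero hi hg)) hg hgh
      rw [mul_comm, ← hgh]
      exact hG i
  have hab : IsRelPrime (h 3) (h 2) := by
    intro c hc3 hc2
    refine hgcd c fun i => ?_
    fin_cases i
    · exact hh0 ▸ dvd_zero c
    · exact hh1 ▸ dvd_zero c
    · exact hc2
    · exact hc3
  have hh : h = ![0, 0, h 2, h 3] := by
    ext1 i
    fin_cases i <;> simp [hh0, hh1]
  have hginv : IsInvariantAlong h g := by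
    obtain ⟨i, hi⟩ := Function.ne_iff.1 hG0
    have hi : g * h i ≠ 0 := hgh i ▸ hi
    exact ((hgh i ▸ hG i : IsInvariantAlong G (g * h i)).of_mul_left hi).of_eq_mul hg hgh
  have hD : ∀ i, h 2 * pderiv 2 (h i) + h 3 * pderiv 3 (h i) = 0 := by
    intro i
    have := (hinv i).sum_mul_pderiv_eq_zero
    rwa [Fin.sum_univ_four, hh0, hh1, zero_mul, zero_mul, zero_add, zero_add] at this
  obtain ⟨hb2, hb3⟩ := pderiv_eq_zero_of_isRelPrime hab.symm (hD 2)
  obtain ⟨ha3, ha2⟩ := pderiv_eq_zero_of_isRelPrime hab ((add_comm _ _).trans (hD 3))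
  replace ha2 := notMem_vars_of_pderiv_eq_zero ha2
  replace ha3 := notMem_vars_of_pderiv_eq_zero ha3
  replace hb2 := notMem_vars_of_pderiv_eq_zero hb2
  replace hb3 := notMem_vars_of_pderiv_eq_zero hb3
  have hmem : ∀ p : MvPolynomial (Fin 4) ℂ, 2 ∉ p.vars → 3 ∉ p.vars →
      p ∈ Algebra.adjoin ℂ ({X 0, X 1} : Set (MvPolynomial (Fin 4) ℂ)) := by
    intro p h2 h3
    rw [mem_adjoin_pair_iff]
    intro k hk
    fin_cases k
    · exact Or.inl rfl
    · exact Or.inr rfl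
    · exact absurd hk h2
    · exact absurd hk h3
  refine ⟨h 3, hmem _ ha2 ha3, h 2, hmem _ hb2 hb3, g,
    mem_adjoin_of_isInvariantAlong hab ha2 ha3 hb2 hb3 _ g le_rfl (hh ▸ hginv), ?_⟩
  ext1 i
  fin_cases i
  · exact h0
  · exact h1
  · exact (hgh 2).trans (mul_comm _ _)
  · exact (hgh 3).trans (mul_comm _ _)

/-- With G = (0, 0, G₂) after conjugation, invariance reads G₂ ∂₂G₂ = 0, so G₂ does not involve x₂.
-/
theorem exists_linConj_normal_form_three {H : PolyMap 3 ℂ} (hq : IsQuasiTranslation H)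
    (hh : IsHomogeneousMap H) :
    ∃ T : Matrix.GeneralLinearGroup (Fin 3) ℂ,
    ∃ g ∈ Algebra.adjoin ℂ ({X 0, X 1} : Set (MvPolynomial (Fin 3) ℂ)),
      linConj T H = ![0, 0, g] := by
  have hinv := hq.isInvariantAlong
  obtain ⟨T, hT0, hT1⟩ : ∃ T : Matrix.GeneralLinearGroup (Fin 3) ℂ,
      linConj T H 0 = 0 ∧ linConj T H 1 = 0 := by
    by_cases hH0 : H = 0
    · exact ⟨1, by simp [linConj_eq, hH0, Fintype.linearCombination_apply],
        by simp [linConj_eq, hH0, Fintype.linearCombination_apply]⟩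
    obtain ⟨g, h, d, hgh, hgcd, hd, hinv'⟩ := hh.exists_reduced hinv hH0
    obtain ⟨l, hl, hl'⟩ := exists_linearIndependent_pair_of_reduced_three hgcd hd hinv'
    exact exists_linConj_three hl fun i => linearCombination_eq_zero_of_eq_mul hgh (hl' i)
  have hG := (IsInvariantAlong.linConj hinv T 2).sum_mul_pderiv_eq_zero
  rw [Fin.sum_univ_three, hT0, hT1, zero_mul, zero_mul, zero_add, zero_add] at hG
  have hp : pderiv 2 (linConj T H 2) = 0 := by
    rcases mul_eq_zero.1 hG with h | h
    · rw [h, map_zero]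
    · exact h
  refine ⟨T, linConj T H 2, ?_, ?_⟩
  · rw [mem_adjoin_pair_iff]
    intro k hk
    fin_cases k
    · exact Or.inl rfl
    · exact Or.inr rfl
    · exact absurd hk (notMem_vars_of_pderiv_eq_zero hp)
  · ext1 i
    fin_cases i
    · exact hT0
    · exact hT1
    · rfl

theorem exists_linConj_normal_form_four {H : PolyMap 4 ℂ} (hq : IsQuasiTranslation H)
    (hh : IsHomogeneousMap H) :
    ∃ T : Matrix.GeneralLinearGroup (Fin 4) ℂ,
    ∃ a ∈ Algebra.adjoin ℂ ({X 0, X 1} : Set (MvPolynomial (Fin 4) ℂ)),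
    ∃ b ∈ Algebra.adjoin ℂ ({X 0, X 1} : Set (MvPolynomial (Fin 4) ℂ)),
    ∃ g ∈ Algebra.adjoin ℂ ({X 0, X 1, a * X 2 - b * X 3} : Set (MvPolynomial (Fin 4) ℂ)),
      linConj T H = ![0, 0, b * g, a * g] := by
  have hinv := hq.isInvariantAlong
  obtain ⟨T, hT0, hT1⟩ : ∃ T : Matrix.GeneralLinearGroup (Fin 4) ℂ,
      linConj T H 0 = 0 ∧ linConj T H 1 = 0 := by
    by_cases hH0 : H = 0
    · exact ⟨1, by simp [linConj_eq, hH0, Fintype.linearCombination_apply],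
        by simp [linConj_eq, hH0, Fintype.linearCombination_apply]⟩
    obtain ⟨g, h, d, hgh, hgcd, hd, hinv'⟩ := hh.exists_reduced hinv hH0
    obtain ⟨l, hl, hl'⟩ := exists_linearIndependent_pair_of_reduced_four hgcd hd hinv'
    exact exists_linConj_four hl fun i => linearCombination_eq_zero_of_eq_mul hgh (hl' i)
  exact ⟨T, exists_normal_form_four (IsInvariantAlong.linConj hinv T) hT0 hT1⟩

end QuasiTrans

end

theorem mainTheorem4 :
    (∀ H : QuasiTrans.PolyMap 3 ℂ,
      QuasiTrans.IsQuasiTranslation H → QuasiTrans.IsHomogeneousMap H →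
      ∃ T : Matrix.GeneralLinearGroup (Fin 3) ℂ,
      ∃ g ∈ Algebra.adjoin ℂ
          ({MvPolynomial.X 0, MvPolynomial.X 1} : Set (MvPolynomial (Fin 3) ℂ)),
        QuasiTrans.linConj T H = ![0, 0, g]) ∧
    (∀ H : QuasiTrans.PolyMap 4 ℂ,
      QuasiTrans.IsQuasiTranslation H → QuasiTrans.IsHomogeneousMap H →
      ∃ T : Matrix.GeneralLinearGroup (Fin 4) ℂ,
      ∃ a ∈ Algebra.adjoin ℂ
          ({MvPolynomial.X 0, MvPolynomial.X 1} : Set (MvPolynomial (Fin 4) ℂ)),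
      ∃ b ∈ Algebra.adjoin ℂ
          ({MvPolynomial.X 0, MvPolynomial.X 1} : Set (MvPolynomial (Fin 4) ℂ)),
      ∃ g ∈ Algebra.adjoin ℂ
          ({MvPolynomial.X 0, MvPolynomial.X 1,
            a * MvPolynomial.X 2 - b * MvPolynomial.X 3} : Set (MvPolynomial (Fin 4) ℂ)),
        QuasiTrans.linConj T H = ![0, 0, b * g, a * g]) := by
  exact ⟨fun _ hq hh => QuasiTrans.exists_linConj_normal_form_three hq hh,
    fun _ hq hh => QuasiTrans.exists_linConj_normal_form_four hq hh⟩
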